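/- Let $R$ be an associative ring with $1$; modules are left $R$-modules, and a quotient of $M$ is any epimorphic image of $M$. A preradical $\sigma$ on $R\text{-Mod}$ is a subfunctor of the identity functor: it assigns to each module $M$ a submodule $\sigma(M)\le M$ with $f(\sigma(M))\subseteq\sigma(N)$ for every homomorphism $f\colon M\to N$. It is a $t$-radical if $\sigma(M)=\sigma(R)M$ for every $M$. Let $\mathbb{T}_\sigma$ be the class of modules $M$ with $\sigma(M)=M$, and let $\mathscr{P}_\sigma$ be the class consisting of the zero modules and the fully $\sigma$-co-first modules, i.e. the non-zero modules having no non-zero quotient in $\mathbb{T}_\sigma$. Put $$\mathcal{CN}_{R\text{-trad}}=\{\mathscr{P}_\sigma \mid \sigma \text{ is a } t\text{-radical on } R\text{-Mod}\}.$$ Let $R\text{-quot}$ be the collection, ordered by inclusion, of the non-empty classes of modules closed under quotients. Each $\mathscr{Q}\in R\text{-quot}$ has a pseudocomplement $\mathscr{Q}^{\perp}$ in $R\text{-quot}$: the largest member of $R\text{-quot}$ whose intersection with $\mathscr{Q}$ consists of zero modules, which is the class of all modules having no non-zero quotient in $\mathscr{Q}$. A class is conatural if it equals $\mathscr{Q}^{\perp}$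 for some $\mathscr{Q}\in R\text{-quot}$; let $R\text{-conat}$ be the collection of conatural classes. Suppose that $R$ is semilocal, i.e. $R/J(R)$ is a semisimple ring, where $J(R)$ is the Jacobson radical. Then the following are equivalent: 1. $R$ is left perfect, i.e. every left $R$-module has a projective cover; 2. $\mathcal{CN}_{R\text{-trad}}=R\text{-conat}$. -/

import Mathlib

open CategoryTheory

universe u

namespace CoFirst

section Rings

/-- A submodule `N` of `M` is superfluous (small): `N + L = M` forces `L = M`. -/
def IsSuperfluous {R M : Type*} [Ring R] [AddCommGroup M] [Module R M]
    (N : Submodule R M) : Prop :=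
  ∀ L : Submodule R M, N ⊔ L = ⊤ → L = ⊤

/-- `p : P → M` is a projective cover: `P` is projective and `p` is an epimorphism with
superfluous kernel. -/
def IsProjectiveCover {R P M : Type*} [Ring R] [AddCommGroup P] [Module R P]
    [AddCommGroup M] [Module R M] (p : P →ₗ[R] M) : Prop :=
  Module.Projective R P ∧ Function.Surjective p ∧ IsSuperfluous (LinearMap.ker p)

/-- A ring is left perfect if each of its left modules has a projective cover. -/
def IsLeftPerfect (R : Type u) [Ring R] : Prop :=
  ∀ M : ModuleCat.{u} R, ∃ (P : ModuleCat.{u} R) (p : P →ₗ[R] M), IsProjectiveCover p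

/-- A ring is semilocal if its quotient by its Jacobson radical is semisimple. -/
def IsSemilocal (R : Type*) [Ring R] : Prop :=
  IsSemisimpleRing (R ⧸ Ring.jacobson R)

end Rings

section Preradicals

/-- The collection of all preradicals on the category of left `R`-modules. A preradical is
a subfunctor of the identity functor. -/
abbrev Pr (R : Type u) [Ring R] := Abelian.Preradical (ModuleCat.{u} R)

/-- The submodule `σ(M)` of `M`. -/
def torsionPart {R : Type u} [Ring R] (σ : Pr R) (M : ModuleCat.{u} R) : Submodule R M :=
  LinearMap.range (σ.ι.app M).hom

/-- The class `𝕋_σ` of `σ`-pretorsion modules, those with `σ(M) = M`. -/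
def pretorsion {R : Type u} [Ring R] (σ : Pr R) : Set (ModuleCat.{u} R) :=
  {M | torsionPart σ M = ⊤}

/-- The left ideal `σ(R)` of `R`. -/
def torsionIdeal {R : Type u} [Ring R] (σ : Pr R) : Ideal R :=
  torsionPart σ (ModuleCat.of R R)

/-- The `t`-radicals: the preradicals `σ` with `σ(M) = σ(R) M` for every module `M`. -/
def tRad (R : Type u) [Ring R] : Set (Pr R) :=
  {σ | ∀ M : ModuleCat.{u} R, torsionPart σ M = torsionIdeal σ • (⊤ : Submodule R M)}

/-- `M` is fully `𝒜`-co-first: `M ≠ 0` and `M` has no non-zero quotient in `𝕋_α` for any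
`α ∈ 𝒜`. -/
def IsFullyCoFirst {R : Type u} [Ring R] (A : Set (Pr R)) (M : ModuleCat.{u} R) : Prop :=
  Nontrivial M ∧ ∀ α ∈ A, ∀ N : Submodule R M,
    ModuleCat.of R (M ⧸ N) ∈ pretorsion α → N = ⊤

/-- The class `𝒫_𝒜` of all fully `𝒜`-co-first modules, together with the zero modules. -/
def fullyCoFirst {R : Type u} [Ring R] (A : Set (Pr R)) : Set (ModuleCat.{u} R) :=
  {M | Subsingleton M ∨ IsFullyCoFirst A M}

/-- `𝒞𝒩_𝒜 = {𝒫_σ | σ ∈ 𝒜}`, where `𝒫_σ = 𝒫_{{σ}}`. -/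
def CN {R : Type u} [Ring R] (A : Set (Pr R)) : Set (Set (ModuleCat.{u} R)) :=
  {C | ∃ σ ∈ A, C = fullyCoFirst {σ}}

end Preradicals

section Conatural

/-- The collection `R`-quot of the non-empty classes of modules that are closed under
quotients, i.e. under images of epimorphisms (so also under isomorphic copies). It is ordered by
inclusion; its least element is the class of zero modules, and meets are intersections. -/
def quotClasses (R : Type u) [Ring R] : Set (Set (ModuleCat.{u} R)) :=
  {C | C.Nonempty ∧ ∀ M ∈ C, ∀ (N : ModuleCat.{u} R) (f : M →ₗ[R] N),
    Function.Surjective f → N ∈ C}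

/-- `K` is the pseudocomplement of `Q` in `R`-quot: the largest member of `R`-quot whose
intersection with `Q` consists of zero modules. -/
def IsPseudocompl {R : Type u} [Ring R] (Q K : Set (ModuleCat.{u} R)) : Prop :=
  IsGreatest {L | L ∈ quotClasses R ∧ ∀ M ∈ Q ∩ L, Subsingleton M} K

/-- The collection `R`-conat of the conatural classes: the skeleton of `R`-quot, that is, the
set of the pseudocomplements of its elements. -/
def conat (R : Type u) [Ring R] : Set (Set (ModuleCat.{u} R)) :=
  {C | ∃ Q ∈ quotClasses R, IsPseudocompl Q C}

/-- The class of the modules that have no non-zero quotient in `Q`. -/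
def perp {R : Type u} [Ring R] (Q : Set (ModuleCat.{u} R)) : Set (ModuleCat.{u} R) :=
  {M | ∀ N : Submodule R M, ModuleCat.of R (M ⧸ N) ∈ Q → N = ⊤}

/-- The pseudocomplement of `Q` exists and is `perp Q`. -/
theorem isPseudocompl_perp {R : Type u} [Ring R] {Q : Set (ModuleCat.{u} R)}
    (hQ : Q ∈ quotClasses R) : IsPseudocompl Q (perp Q) := by
  refine ⟨⟨⟨⟨ModuleCat.of R PUnit, fun N _ => Subsingleton.elim _ _⟩, ?_⟩, ?_⟩, ?_⟩
  · intro M hM N f hf L hL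
    let g : M →ₗ[R] (N ⧸ L) := L.mkQ ∘ₗ f
    have hg : Function.Surjective g := (Submodule.mkQ_surjective L).comp hf
    have hk : LinearMap.ker g = ⊤ := hM _ (hQ.2 _ hL (ModuleCat.of R (M ⧸ LinearMap.ker g))
      (g.quotKerEquivOfSurjective hg).symm.toLinearMap (LinearEquiv.surjective _))
    rw [eq_top_iff]
    intro x _
    obtain ⟨y, rfl⟩ := hf x
    have hy : y ∈ LinearMap.ker g := hk ▸ Submodule.mem_top
    simpa [g] using hy
  · rintro M ⟨hMQ, hM⟩
    have h := hM ⊥ (hQ.2 M hMQ _ (Submodule.mkQ ⊥) (Submodule.mkQ_surjective _))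
    exact (Submodule.subsingleton_iff R).1 (subsingleton_of_bot_eq_top h)
  · rintro L ⟨hL, hQL⟩ M hM N hN
    have h := hQL _ ⟨hN, hL.2 M hM (ModuleCat.of R (M ⧸ N)) N.mkQ N.mkQ_surjective⟩
    exact Submodule.Quotient.subsingleton_iff.1 h

/-- The conatural classes are the classes `perp Q` with `Q` in `R`-quot. -/
theorem mem_conat_iff {R : Type u} [Ring R] {C : Set (ModuleCat.{u} R)} :
    C ∈ conat R ↔ ∃ Q ∈ quotClasses R, C = perp Q :=
  ⟨fun ⟨Q, hQ, h⟩ => ⟨Q, hQ, h.unique (isPseudocompl_perp hQ)⟩,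
    fun ⟨Q, hQ, h⟩ => ⟨Q, hQ, h ▸ isPseudocompl_perp hQ⟩⟩

end Conatural

end CoFirst

/-! Write J for the Jacobson radical. Both conditions amount to Nakayama's lemma for all modules: JM
= M only for M = 0. Projective covers give Nakayama because a projective P with JP = P is zero.
Conversely, Nakayama forces J to be nil, so idempotents lift from R/J; covers of simple modules add
up to covers of semisimple ones, and a cover of M/JM lifts to one of M. Given Nakayama, every
non-zero module over a semilocal ring has a simple quotient, so `perp Q` depends only on the simple
modules in Q. These are the simple S with IS = S, where I is the intersection of the annihilators of
the simples outside Q, so I defines the required t-radical. For the converse, let Q be the class JM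
= M and let τ be a t-radical with 𝒫_τ = Q^⊥⊥. Simple modules lie in Q^⊥, hence outside 𝒫_τ, which
forces τ(R) = R. So 𝒫_τ is zero, and Q lies in it. -/

namespace CoFirst

/-! ### Nakayama's lemma and its derivation from projective covers. -/

section Nakayama

/-- Nakayama's lemma for all modules: a module `M` with `J(R) M = M` is zero. -/
def NakayamaProperty (R : Type u) [Ring R] : Prop :=
  ∀ (M : Type u) [AddCommGroup M] [Module R M],
    Ring.jacobson R • (⊤ : Submodule R M) = ⊤ → Subsingleton M

theorem smul_top_quotient_eq_top_iff {R M : Type*} [Ring R] [AddCommGroup M] [Module R M]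
    (I : Ideal R) (N : Submodule R M) :
    I • (⊤ : Submodule R (M ⧸ N)) = ⊤ ↔ I • (⊤ : Submodule R M) ⊔ N = ⊤ := by
  have hc : Submodule.comap N.mkQ (I • ⊤) = I • (⊤ : Submodule R M) ⊔ N := by
    rw [Submodule.comap_smul_top_of_surjective _ _ N.mkQ_surjective, Submodule.ker_mkQ]
  rw [← hc, ← Submodule.comap_top N.mkQ,
    (Submodule.comap_injective_of_surjective N.mkQ_surjective).eq_iff]

theorem NakayamaProperty.isSuperfluous {R : Type u} [Ring R] (hR : NakayamaProperty R)
    {M : Type u} [AddCommGroup M] [Module R M] :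
    IsSuperfluous (Ring.jacobson R • (⊤ : Submodule R M)) := fun L hL =>
  Submodule.Quotient.subsingleton_iff.1 (hR _ ((smul_top_quotient_eq_top_iff _ L).2 hL))

theorem isUnit_one_sub_of_mem_jacobson_bot {S : Type*} [Ring S] {x : S}
    (hx : x ∈ Ideal.jacobson (⊥ : Ideal S)) : IsUnit (1 - x) := by
  rw [Ideal.mem_jacobson_iff] at hx
  obtain ⟨z, hz⟩ := hx (-1)
  obtain ⟨w, hw⟩ := hx z
  rw [Ideal.mem_bot] at hz hw
  have h1 : z * (1 - x) = 1 := by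
    rw [← sub_eq_zero, ← hz]; noncomm_ring
  have h2 : z * x + 1 = z := by
    rw [← h1]; noncomm_ring
  have h3 : w * z = 1 := by
    rw [← h2, ← sub_eq_zero, ← hw]; noncomm_ring
  have h4 : 1 - x = w := by
    calc 1 - x = w * z * (1 - x) := by rw [h3, one_mul]
      _ = w := by rw [mul_assoc, h1, mul_one]
  exact ⟨⟨1 - x, z, by rw [h4, h3], h1⟩, rfl⟩

-- Matrices with entries in J lie in the Jacobson radical of the matrix ring.
open Matrix in
theorem isUnit_one_sub_of_forall_mem_jacobson {R n : Type*} [Ring R] [Fintype n] [DecidableEq n]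
    {A : Matrix n n R} (hA : ∀ i j, A i j ∈ Ring.jacobson R) : IsUnit (1 - A) := by
  apply isUnit_one_sub_of_mem_jacobson_bot
  have h := Ideal.matrix_jacobson_le (n := n) (⊥ : Ideal R)
  rw [Ideal.matrix_bot] at h
  refine h fun i j => ?_
  have := hA i j
  rw [Ring.jacobson_eq_sInf_isMaximal] at this
  simpa [Ideal.jacobson] using this

theorem apply_mem_of_mem_smul_top {R X : Type*} [Ring R] (I : Ideal R) [I.IsTwoSided]
    {f : X →₀ R} (hf : f ∈ I • (⊤ : Submodule R (X →₀ R))) (x : X) : f x ∈ I := by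
  have h := Submodule.smul_top_le_comap_smul_top I (Finsupp.lapply (R := R) x : (X →₀ R) →ₗ[R] R) hf
  simpa using h

/-- Bass: a projective module `P` with `J(R) P = P` is zero. -/
theorem subsingleton_of_projective_of_jacobson_smul_top {R P : Type*} [Ring R] [AddCommGroup P]
    [Module R P] [Module.Projective R P] (h : Ring.jacobson R • (⊤ : Submodule R P) = ⊤) :
    Subsingleton P := by
  classical
  obtain ⟨s, hs⟩ := (Module.projective_def' (R := R) (P := P)).1 ‹_›
  have hmem (p q : P) : s p q ∈ Ring.jacobson R :=
    apply_mem_of_mem_smul_top _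
      (Submodule.smul_top_le_comap_smul_top _ s (h.ge (Submodule.mem_top (x := p)))) q
  refine subsingleton_of_forall_eq 0 fun x => ?_
  have hx : (s x).sum (fun i r => r • i) = x := by
    simpa [Finsupp.linearCombination_apply] using LinearMap.congr_fun hs x
  let v : (s x).support → R := fun i => s x i
  let A : Matrix (s x).support (s x).support R := fun i j => s i j
  -- Applying the section s to x = Σ s(x)_i i gives v = vA. The entries of A lie in J, so 1 - A is
  -- invertible and v = 0.
  have hv : Matrix.vecMul v (1 - A) = 0 := by
    rw [Matrix.vecMul_sub, Matrix.vecMul_one, sub_eq_zero]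
    ext j
    have := congrArg (fun y => s y j) hx
    simp only [Finsupp.sum, map_sum, map_smul, Finsupp.finsetSum_apply, Finsupp.smul_apply,
      smul_eq_mul] at this
    simp only [Matrix.vecMul, dotProduct, v, A]
    rw [← this, Finset.sum_coe_sort (s x).support (fun i => s x i * s i j)]
  obtain ⟨u, hu⟩ := isUnit_one_sub_of_forall_mem_jacobson (A := A) fun i j => hmem i j
  have hv0 : v = 0 := by
    rw [← Matrix.vecMul_one v, ← u.mul_inv, hu, ← Matrix.vecMul_vecMul, hv, Matrix.zero_vecMul]
  rw [← hx]
  refine Finset.sum_eq_zero fun i hi => ?_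
  have := congrFun hv0 ⟨i, hi⟩
  simp only [v, Pi.zero_apply] at this
  simp only [this, zero_smul]

/-- If JM = M and P covers M, then JP + ker p = P; the kernel is superfluous, so JP = P and P = 0.
-/
theorem IsLeftPerfect.nakayamaProperty {R : Type u} [Ring R] (hR : IsLeftPerfect R) :
    NakayamaProperty R := by
  intro M _ _ hM
  obtain ⟨P, p, hP, hp, hk⟩ := hR (ModuleCat.of R M)
  have h : Ring.jacobson R • (⊤ : Submodule R P) = ⊤ := by
    apply hk
    rw [sup_comm, ← Submodule.comap_smul_top_of_surjective _ _ hp]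
    exact (congrArg _ hM).trans (Submodule.comap_top _)
  have := subsingleton_of_projective_of_jacobson_smul_top h
  exact hp.subsingleton

end Nakayama

/-! ### Semisimple and simple quotients over a semilocal ring. -/

section Semilocal

theorem IsSemilocal.isSemisimpleModule_of_isTorsionBySet {R M : Type*} [Ring R] [AddCommGroup M]
    [Module R M] (hR : IsSemilocal R) (hM : Module.IsTorsionBySet R M (Ring.jacobson R)) :
    IsSemisimpleModule R M := by
  have : IsSemisimpleRing (R ⧸ Ring.jacobson R) := hR
  let _ := hM.module
  let f : M →ₛₗ[Ideal.Quotient.mk (Ring.jacobson R)] M := ⟨AddHom.id _, fun _ _ => rfl⟩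
  exact (LinearMap.isSemisimpleModule_iff_of_bijective f Function.bijective_id).2 inferInstance

theorem IsSemilocal.isSemisimpleModule_quotient {R M : Type*} [Ring R] [AddCommGroup M]
    [Module R M] (hR : IsSemilocal R) :
    IsSemisimpleModule R (M ⧸ Ring.jacobson R • (⊤ : Submodule R M)) :=
  hR.isSemisimpleModule_of_isTorsionBySet
    (Module.isTorsionBySet_quotient_ideal_smul M (Ring.jacobson R))

/-- By Nakayama JM + N is still proper, and the quotient by it is killed by J, hence semisimple and
non-zero. -/
theorem exists_isCoatom_ge {R : Type u} [Ring R] (hR : IsSemilocal R) (hN : NakayamaProperty R)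
    {M : Type u} [AddCommGroup M] [Module R M] {N : Submodule R M} (h : N ≠ ⊤) :
    ∃ L, IsCoatom L ∧ N ≤ L := by
  set K := Ring.jacobson R • (⊤ : Submodule R M) ⊔ N
  have hK : K ≠ ⊤ := fun hK => h (hN.isSuperfluous N hK)
  have : IsSemisimpleModule R (M ⧸ K) := by
    refine hR.isSemisimpleModule_of_isTorsionBySet fun x r => ?_
    obtain ⟨x, rfl⟩ := K.mkQ_surjective x
    rw [← map_smul]
    exact (Submodule.Quotient.mk_eq_zero _).2
      (Submodule.mem_sup_left (Submodule.smul_mem_smul r.2 Submodule.mem_top))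
  obtain h | ⟨L, hL, -⟩ := eq_top_or_exists_le_coatom (⊥ : Submodule R (M ⧸ K))
  · exact absurd (Submodule.Quotient.subsingleton_iff.1
      ((Submodule.subsingleton_iff R).1 (subsingleton_of_bot_eq_top h))) hK
  · exact ⟨_, (Submodule.isCoatom_comap_iff K.mkQ_surjective).2 hL,
      le_sup_right.trans (Submodule.le_comap_mkQ K L)⟩

end Semilocal

/-! ### Nilpotence of J, lifting of idempotents, covers of simple modules. -/

section Lifting

open Polynomial in
/-- If `J(R) M = M` implies `M = 0` then the Jacobson radical is nil. -/
theorem NakayamaProperty.isNilpotent {R : Type u} [Ring R] (hR : NakayamaProperty R) {a : R}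
    (ha : a ∈ Ring.jacobson R) : IsNilpotent a := by
  -- Modulo 1 - aX one has rX^n = raX^(n+1), so J times the quotient is the whole quotient, which
  -- thus vanishes. An inverse p of 1 - aX must have coefficients a^n, and p has finite degree.
  let I : Ideal R[X] := Ideal.span {1 - C a * X}
  let N : Submodule R R[X] := I.restrictScalars R
  have hle : (⊤ : Submodule R R[X]) ≤ Ring.jacobson R • ⊤ ⊔ N := by
    intro p _
    induction p using Polynomial.induction_on' with
    | add p q hp hq => exact add_mem (hp trivial) (hq trivial)
    | monomial n r =>
      have hd : (monomial n r : R[X]) = (r * a) • X ^ (n + 1) + monomial n r * (1 - C a * X) := by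
        rw [mul_sub, mul_one, ← mul_assoc, monomial_mul_C, monomial_mul_X, ← C_mul_X_pow_eq_monomial,
          ← C_mul_X_pow_eq_monomial, smul_eq_C_mul]
        abel
      rw [hd]
      exact Submodule.add_mem_sup (Submodule.smul_mem_smul (Ideal.mul_mem_left _ _ ha) trivial)
        (I.mul_mem_left _ (Ideal.mem_span_singleton_self _))
  have hN := hR.isSuperfluous N (top_le_iff.1 hle)
  have h1 : (1 : R[X]) ∈ I := by
    have : (1 : R[X]) ∈ N := hN ▸ trivial
    exact this
  obtain ⟨p, hp⟩ := Ideal.mem_span_singleton'.1 h1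
  rw [mul_sub, mul_one, ← mul_assoc] at hp
  have hc (n : ℕ) : p.coeff n = a ^ n := by
    induction n with
    | zero => simpa using congrArg (coeff · 0) hp
    | succ n ih =>
      have := congrArg (coeff · (n + 1)) hp
      simpa [coeff_one, ih, ← pow_succ, sub_eq_zero] using this
  exact ⟨p.natDegree + 1, by rw [← hc, coeff_eq_zero_of_natDegree_lt (Nat.lt_succ_self _)]⟩

/-- The module `R ⧸ R e` is projective for an idempotent `e`. -/
theorem projective_quotient_span_idempotent {R : Type*} [Ring R] {e : R}
    (he : IsIdempotentElem e) : Module.Projective R (R ⧸ Ideal.span {e}) := by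
  -- The projection R → R/Re is split by r ↦ r(1 - e), which kills Re.
  refine Module.Projective.of_split
    ((Ideal.span {e}).liftQ (LinearMap.toSpanSingleton R R (1 - e)) ?_) (Ideal.span {e}).mkQ ?_
  · rw [Ideal.span_le, Set.singleton_subset_iff]
    simp [mul_sub, he.eq]
  · apply Submodule.linearMap_qext
    ext
    simp

/-- A simple module over a semilocal ring with the Nakayama property is a quotient of a projective
module `P` by a submodule of `J(R) P`. -/
theorem exists_projective_cover_of_isSimpleModule {R : Type u} [Ring R] (hR : IsSemilocal R)
    (hN : NakayamaProperty R) (S : Type u) [AddCommGroup S] [Module R S] [IsSimpleModule R S] :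
    ∃ (P : ModuleCat.{u} R) (p : P →ₗ[R] S), Module.Projective R P ∧ Function.Surjective p ∧
      LinearMap.ker p ≤ Ring.jacobson R • (⊤ : Submodule R P) := by
  have : IsSemisimpleRing (R ⧸ Ring.jacobson R) := hR
  obtain ⟨s, hs⟩ := @exists_ne S (IsSimpleModule.nontrivial R S) 0
  let g := LinearMap.toSpanSingleton R S s
  have hg : Function.Surjective g := IsSimpleModule.toSpanSingleton_surjective R hs
  have hm : Ideal.IsMaximal (LinearMap.ker g) := IsSimpleModule.ker_toSpanSingleton_isMaximal R hs
  let π := Ideal.Quotient.mk (Ring.jacobson R)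
  obtain ⟨e', he', hspan⟩ :=
    IsSemisimpleRing.ideal_eq_span_idempotent (Ideal.map π (LinearMap.ker g))
  obtain ⟨e, he, rfl⟩ := exists_isIdempotentElem_eq_of_ker_isNilpotent π
    (fun x hx => hN.isNilpotent (Ideal.mk_ker.le hx)) e' (Ideal.Quotient.mk_surjective e') he'
  -- The maximal left ideal ker g contains J, so it is recovered from its image in R/J. Hence R/Re
  -- maps onto S with kernel the image of J.
  have hker : LinearMap.ker g = Ideal.span {e} ⊔ Ring.jacobson R := by
    have h := congrArg (Ideal.comap π) hspan
    rw [← Set.image_singleton, ← Ideal.map_span] at h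
    rw [Ideal.comap_map_of_surjective' π Ideal.Quotient.mk_surjective,
      Ideal.comap_map_of_surjective' π Ideal.Quotient.mk_surjective, Ideal.mk_ker,
      sup_eq_left.2 (Ring.jacobson_le_of_isMaximal _)] at h
    exact h
  have hle : Ideal.span {e} ≤ LinearMap.ker g := hker ▸ le_sup_left
  refine ⟨ModuleCat.of R (R ⧸ Ideal.span {e}), (Ideal.span {e}).liftQ g hle,
    projective_quotient_span_idempotent he, ?_, ?_⟩
  · rw [← LinearMap.range_eq_top, Submodule.range_liftQ, LinearMap.range_eq_top.2 hg]
  · rw [Submodule.ker_liftQ, hker, Submodule.map_sup]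
    refine sup_le ?_ ?_
    · simp [Submodule.mkQ_map_self]
    · exact Submodule.map_le_smul_top _ _

end Lifting

/-! ### Projective covers of semisimple modules, then of all modules. -/

section Covers

theorem exists_projective_cover_of_isSemisimpleModule {R : Type u} [Ring R] (hR : IsSemilocal R)
    (hN : NakayamaProperty R) (M : Type u) [AddCommGroup M] [Module R M] [IsSemisimpleModule R M] :
    ∃ (P : ModuleCat.{u} R) (p : P →ₗ[R] M), Module.Projective R P ∧ Function.Surjective p ∧
      LinearMap.ker p ≤ Ring.jacobson R • (⊤ : Submodule R P) := by
  classical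
  obtain ⟨s, e, hs⟩ := isSemisimpleModule_iff_exists_linearEquiv_dfinsupp.1 ‹IsSemisimpleModule R M›
  choose P p hP hp hk using fun m : s =>
    exists_projective_cover_of_isSimpleModule hR hN m.1
  refine ⟨ModuleCat.of R (Π₀ m, P m), e.symm.toLinearMap ∘ₗ DFinsupp.mapRange.linearMap p,
    inferInstanceAs (Module.Projective R (Π₀ m, P m)),
    e.symm.surjective.comp ((DFinsupp.mapRange_surjective _ fun m => map_zero (p m)).2 hp), ?_⟩
  intro x hx
  change Π₀ m, P m at x
  change e.symm (DFinsupp.mapRange.linearMap p x) = 0 at hx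
  rw [LinearEquiv.map_eq_zero_iff] at hx
  have hxm (m : s) : x m ∈ Ring.jacobson R • (⊤ : Submodule R (P m)) :=
    hk m (by simpa using DFunLike.congr_fun hx m)
  change x ∈ Ring.jacobson R • (⊤ : Submodule R (Π₀ m, P m))
  rw [← DFinsupp.sum_single (f := x)]
  exact Submodule.sum_mem _ fun m _ =>
    Submodule.smul_top_le_comap_smul_top _ (DFinsupp.lsingle m) (hxm m)

theorem NakayamaProperty.isLeftPerfect {R : Type u} [Ring R] (hN : NakayamaProperty R)
    (hR : IsSemilocal R) : IsLeftPerfect R := by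
  intro M
  let K := Ring.jacobson R • (⊤ : Submodule R M)
  have : IsSemisimpleModule R (M ⧸ K) := hR.isSemisimpleModule_quotient
  obtain ⟨P, p, hP, hp, hk⟩ := exists_projective_cover_of_isSemisimpleModule hR hN (M ⧸ K)
  obtain ⟨q, hq⟩ := Module.projective_lifting_property K.mkQ p K.mkQ_surjective
  refine ⟨P, q, hP, ?_, fun L hL => hN.isSuperfluous L ?_⟩
  -- The lift q is onto modulo JM, and JM is superfluous.
  · rw [← LinearMap.range_eq_top]
    apply hN.isSuperfluous
    rw [eq_top_iff]
    intro x _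
    obtain ⟨y, hy⟩ := hp (K.mkQ x)
    rw [← hq, LinearMap.comp_apply] at hy
    rw [← sub_add_cancel x (q y)]
    exact Submodule.add_mem_sup ((Submodule.Quotient.eq K).1 hy.symm) ⟨y, rfl⟩
  -- Here ker q ≤ ker p ≤ JP, and JP is superfluous.
  · refine top_le_iff.1 (hL.ge.trans (sup_le_sup_right (le_trans ?_ hk) _))
    rw [← hq]
    exact LinearMap.ker_le_ker_comp _ _

end Covers

/-! ### t-radicals and two-sided ideals. -/

section TRadicals

theorem torsionPart_map_le {R : Type u} [Ring R] (σ : Pr R) {M N : ModuleCat.{u} R} (f : M ⟶ N) :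
    (torsionPart σ M).map f.hom ≤ torsionPart σ N := by
  rintro _ ⟨_, ⟨x, rfl⟩, rfl⟩
  exact ⟨(σ.obj.left.map f).hom x,
    LinearMap.congr_fun (congrArg ModuleCat.Hom.hom (σ.ι.naturality f)) x⟩

/-- Right multiplication by b is an endomorphism of the left module R, so it preserves σ(R). -/
instance torsionIdeal_isTwoSided {R : Type u} [Ring R] (σ : Pr R) : (torsionIdeal σ).IsTwoSided :=
  ⟨fun {a} b ha => by
    have h := torsionPart_map_le σ (ModuleCat.ofHom (LinearMap.toSpanSingleton R R b))
    exact h ⟨a, ha, rfl⟩⟩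

/-- The functor `M ↦ I M` on the category of modules. -/
def idealSMulFunctor {R : Type u} [Ring R] (I : Ideal R) : ModuleCat.{u} R ⥤ ModuleCat.{u} R where
  obj M := ModuleCat.of R (I • (⊤ : Submodule R M) : Submodule R M)
  map f := ModuleCat.ofHom (f.hom.restrict fun _ hx =>
    Submodule.smul_top_le_comap_smul_top I f.hom hx)

/-- The inclusion of `M ↦ I M` in the identity functor. -/
def idealSMulInclusion {R : Type u} [Ring R] (I : Ideal R) :
    idealSMulFunctor I ⟶ 𝟭 (ModuleCat.{u} R) where
  app M := ModuleCat.ofHom (I • (⊤ : Submodule R M)).subtype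

instance {R : Type u} [Ring R] (I : Ideal R) : Mono (idealSMulInclusion I) := by
  have (M : ModuleCat.{u} R) : Mono ((idealSMulInclusion I).app M) :=
    (ModuleCat.mono_iff_injective _).2 Subtype.val_injective
  exact NatTrans.mono_of_mono_app _

/-- The preradical `M ↦ I M`. -/
def idealSMulPreradical {R : Type u} [Ring R] (I : Ideal R) : Pr R :=
  MonoOver.mk (idealSMulInclusion I)

theorem torsionPart_idealSMulPreradical {R : Type u} [Ring R] (I : Ideal R) (M : ModuleCat.{u} R) :
    torsionPart (idealSMulPreradical I) M = I • (⊤ : Submodule R M) :=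
  Submodule.range_subtype _

theorem torsionIdeal_idealSMulPreradical {R : Type u} [Ring R] (I : Ideal R) [I.IsTwoSided] :
    torsionIdeal (idealSMulPreradical I) = I :=
  (torsionPart_idealSMulPreradical I _).trans (I.mul_top)

theorem idealSMulPreradical_mem_tRad {R : Type u} [Ring R] (I : Ideal R) [I.IsTwoSided] :
    idealSMulPreradical I ∈ tRad R := fun M => by
  rw [torsionPart_idealSMulPreradical, torsionIdeal_idealSMulPreradical]

theorem mem_pretorsion_iff {R : Type u} [Ring R] {σ : Pr R} (hσ : σ ∈ tRad R)
    {M : ModuleCat.{u} R} : M ∈ pretorsion σ ↔ torsionIdeal σ • (⊤ : Submodule R M) = ⊤ := by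
  rw [← hσ M]; rfl

theorem pretorsion_mem_quotClasses {R : Type u} [Ring R] (σ : Pr R) :
    pretorsion σ ∈ quotClasses R := by
  refine ⟨⟨ModuleCat.of R PUnit, Subsingleton.elim _ _⟩, fun M hM N f hf => ?_⟩
  refine top_le_iff.1 (le_trans ?_ (torsionPart_map_le σ (ModuleCat.ofHom f)))
  rw [show torsionPart σ M = ⊤ from hM, Submodule.map_top]
  exact (LinearMap.range_eq_top.2 hf).ge

theorem fullyCoFirst_singleton {R : Type u} [Ring R] (σ : Pr R) :
    fullyCoFirst {σ} = perp (pretorsion σ) := by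
  ext M
  constructor
  · rintro (h | ⟨-, h⟩) N hN
    · exact Subsingleton.elim _ _
    · exact h σ rfl N hN
  · intro h
    obtain hM | hM := subsingleton_or_nontrivial M
    · exact .inl hM
    · refine .inr ⟨hM, ?_⟩
      rintro _ rfl
      exact h

theorem CN_tRad_subset_conat (R : Type u) [Ring R] : CN (tRad R) ⊆ conat R := by
  rintro _ ⟨σ, -, rfl⟩
  exact mem_conat_iff.2 ⟨_, pretorsion_mem_quotClasses σ, fullyCoFirst_singleton σ⟩

end TRadicals

/-! ### Pseudocomplements and simple quotients. -/

section Perp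

theorem perp_mem_quotClasses {R : Type u} [Ring R] {Q : Set (ModuleCat.{u} R)}
    (hQ : Q ∈ quotClasses R) : perp Q ∈ quotClasses R :=
  (isPseudocompl_perp hQ).1.1

theorem subset_perp_perp {R : Type u} [Ring R] {Q : Set (ModuleCat.{u} R)}
    (hQ : Q ∈ quotClasses R) : Q ⊆ perp (perp Q) := by
  refine (isPseudocompl_perp (perp_mem_quotClasses hQ)).2 ⟨hQ, fun M hM => ?_⟩
  exact (isPseudocompl_perp hQ).1.2 M hM.symm

/-- If all non-zero modules have simple quotients, then `perp` depends only on simple modules. -/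
theorem perp_subset_perp_of_simple {R : Type u} [Ring R] (hR : IsSemilocal R)
    (hN : NakayamaProperty R) {Q Q' : Set (ModuleCat.{u} R)} (hQ' : Q' ∈ quotClasses R)
    (h : ∀ S ∈ Q', IsSimpleModule R S → S ∈ Q) : perp Q ⊆ perp Q' := by
  intro M hM N hMN
  by_contra hne
  obtain ⟨L, hL, hNL⟩ := exists_isCoatom_ge hR hN hne
  have hs : IsSimpleModule R (M ⧸ L) := isSimpleModule_iff_isCoatom.2 hL
  refine hL.1 (hM L (h _ (hQ'.2 _ hMN (ModuleCat.of R (M ⧸ L)) (Submodule.factor hNL) ?_) hs))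
  exact Submodule.factor_surjective hNL

end Perp

/-! ### Separating simple modules by a two-sided ideal. -/

section SimpleModules

/-- The intersection of the annihilators of the simple modules outside of `Q`. -/
def simpleAnnihilator {R : Type u} [Ring R] (Q : Set (ModuleCat.{u} R)) : Ideal R :=
  ⨅ (S : ModuleCat.{u} R) (_ : IsSimpleModule R S) (_ : S ∉ Q), Module.annihilator R S

theorem mem_simpleAnnihilator {R : Type u} [Ring R] {Q : Set (ModuleCat.{u} R)} {r : R} :
    r ∈ simpleAnnihilator Q ↔
      ∀ S : ModuleCat.{u} R, IsSimpleModule R S → S ∉ Q → ∀ s : S, r • s = 0 := by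
  simp [simpleAnnihilator, Submodule.mem_iInf, Module.mem_annihilator]

instance simpleAnnihilator_isTwoSided {R : Type u} [Ring R] (Q : Set (ModuleCat.{u} R)) :
    (simpleAnnihilator Q).IsTwoSided :=
  ⟨fun {a} b ha => mem_simpleAnnihilator.2 fun S hS hSQ s => by
    rw [mul_smul]; exact mem_simpleAnnihilator.1 ha S hS hSQ _⟩

/-- For a semilocal ring, the simple modules in `Q` are those that are not killed by the
intersection of the annihilators of the simple modules outside of `Q`. -/
theorem simpleAnnihilator_smul_top_eq_top_iff {R : Type u} [Ring R] (hR : IsSemilocal R)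
    {Q : Set (ModuleCat.{u} R)} (hQ : Q ∈ quotClasses R) {S : ModuleCat.{u} R}
    (hS : IsSimpleModule R S) :
    simpleAnnihilator Q • (⊤ : Submodule R S) = ⊤ ↔ S ∈ Q := by
  have hnt := IsSimpleModule.nontrivial R S
  constructor
  · intro h
    by_contra hSQ
    refine bot_ne_top (α := Submodule R S)
      (top_le_iff.1 (h.ge.trans (Submodule.smul_le.2 ?_)))
    intro r hr s _
    exact mem_simpleAnnihilator.1 hr S hS hSQ s
  · intro hSQ
    refine (eq_bot_or_eq_top _).resolve_left fun hbot => ?_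
    set I := simpleAnnihilator Q
    have hIS : ∀ r ∈ I, ∀ s : S, r • s = 0 := fun r hr s =>
      (Submodule.mem_bot R).1 (hbot ▸ Submodule.smul_mem_smul hr trivial)
    have hJI : Ring.jacobson R ≤ I := fun r hr => mem_simpleAnnihilator.2 fun T hT _ t =>
      Module.mem_annihilator.1 (IsSemisimpleModule.jacobson_le_annihilator R T hr) t
    have hss : IsSemisimpleModule R (R ⧸ I) := by
      refine hR.isSemisimpleModule_of_isTorsionBySet fun x r => ?_
      obtain ⟨x, rfl⟩ := I.mkQ_surjective x
      rw [← map_smul]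
      exact (Submodule.Quotient.mk_eq_zero _).2 (I.mul_mem_right x (hJI r.2))
    obtain ⟨s, hs⟩ := exists_ne (0 : S)
    let p : (R ⧸ I) →ₗ[R] S := I.liftQ (LinearMap.toSpanSingleton R S s) fun r hr => hIS r hr s
    have hp : Function.Surjective p := by
      rw [← LinearMap.range_eq_top, show p.range = _ from Submodule.range_liftQ _ _ _,
        LinearMap.range_eq_top]
      exact IsSimpleModule.toSpanSingleton_surjective R hs
    -- If IS = 0, then S is a direct summand of the semisimple module R/I. A non-zero element of its
    -- image there fails to kill some simple T outside Q, giving a non-zero map S → T; it is onto,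
    -- so T lies in Q, a contradiction.
    obtain ⟨g, hg⟩ := IsSemisimpleModule.lifting_property p hp (LinearMap.id : S →ₗ[R] S)
    obtain ⟨x, hx⟩ := I.mkQ_surjective (g s)
    have hxI : x ∉ I := fun hxI => hs (by
      have h1 := LinearMap.congr_fun hg s
      rw [LinearMap.comp_apply, ← hx, Submodule.mkQ_apply, (Submodule.Quotient.mk_eq_zero _).2 hxI,
        map_zero] at h1
      exact h1.symm)
    rw [mem_simpleAnnihilator] at hxI
    push Not at hxI
    obtain ⟨T, hT, hTQ, t, ht⟩ := hxI
    let q : (R ⧸ I) →ₗ[R] T := I.liftQ (LinearMap.toSpanSingleton R T t) fun r hr =>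
      mem_simpleAnnihilator.1 hr T hT hTQ t
    have hqg : q ∘ₗ g ≠ 0 := fun h0 => ht (by
      have h1 := LinearMap.congr_fun h0 s
      rw [LinearMap.comp_apply, ← hx] at h1
      exact h1)
    exact hTQ (hQ.2 S hSQ T _ (LinearMap.surjective_of_ne_zero hqg))

end SimpleModules

/-! ### The two implications between Nakayama's lemma and the equality of classes. -/

section Main

theorem NakayamaProperty.conat_subset_CN_tRad {R : Type u} [Ring R] (hN : NakayamaProperty R)
    (hR : IsSemilocal R) : conat R ⊆ CN (tRad R) := by
  intro C hC
  obtain ⟨Q, hQ, rfl⟩ := mem_conat_iff.1 hC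
  have hσ := idealSMulPreradical_mem_tRad (simpleAnnihilator Q)
  have hiff (S : ModuleCat.{u} R) (hS : IsSimpleModule R S) :
      S ∈ pretorsion (idealSMulPreradical (simpleAnnihilator Q)) ↔ S ∈ Q := by
    rw [mem_pretorsion_iff hσ, torsionIdeal_idealSMulPreradical,
      simpleAnnihilator_smul_top_eq_top_iff hR hQ hS]
  refine ⟨_, hσ, ?_⟩
  rw [fullyCoFirst_singleton]
  exact (perp_subset_perp_of_simple hR hN (pretorsion_mem_quotClasses _)
    fun S hS h => (hiff S h).1 hS).antisymm
    (perp_subset_perp_of_simple hR hN hQ fun S hS h => (hiff S h).2 hS)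

/-- A two-sided ideal `I` with `I S ≠ 0` for all simple modules `S` is the whole ring. -/
theorem eq_top_of_forall_simple {R : Type u} [Ring R] (I : Ideal R) [I.IsTwoSided]
    (h : ∀ S : ModuleCat.{u} R, IsSimpleModule R S → I • (⊤ : Submodule R S) = ⊤) : I = ⊤ := by
  by_contra hI
  obtain ⟨m, hm, hIm⟩ := Ideal.exists_le_maximal I hI
  have h1 := h (ModuleCat.of R (R ⧸ m)) (isSimpleModule_iff_isCoatom.2 (Ideal.isMaximal_def.1 hm))
  have h2 := (smul_top_quotient_eq_top_iff I m).1 h1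
  refine hm.ne_top (top_le_iff.1 (h2.ge.trans (sup_le (le_trans ?_ hIm) le_rfl)))
  exact I.mul_top.le

theorem nakayamaProperty_of_conat_subset {R : Type u} [Ring R] (h : conat R ⊆ CN (tRad R)) :
    NakayamaProperty R := by
  intro M _ _ hM
  have hσ := idealSMulPreradical_mem_tRad (Ring.jacobson R)
  set Q := pretorsion (idealSMulPreradical (Ring.jacobson R)) with hQdef
  have hQ : Q ∈ quotClasses R := pretorsion_mem_quotClasses _
  have hmem (N : ModuleCat.{u} R) : N ∈ Q ↔ Ring.jacobson R • (⊤ : Submodule R N) = ⊤ := by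
    rw [hQdef, mem_pretorsion_iff hσ, torsionIdeal_idealSMulPreradical]
  have hQp := perp_mem_quotClasses hQ
  obtain ⟨τ, hτ, hperp⟩ := h (mem_conat_iff.2 ⟨_, hQp, rfl⟩)
  rw [fullyCoFirst_singleton] at hperp
  -- A simple S has JS = 0, so it lies in Q^⊥ and not in Q^⊥⊥ = 𝒫_τ. Its only non-zero quotient is
  -- itself up to isomorphism, so τ(R)S = S.
  have hτtop : torsionIdeal τ = ⊤ := by
    refine eq_top_of_forall_simple _ fun S hS => ?_
    have hnt := IsSimpleModule.nontrivial R S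
    have hSp : S ∈ perp Q := by
      intro N hN
      refine (eq_bot_or_eq_top N).resolve_left fun hbot => ?_
      have h1 := (smul_top_quotient_eq_top_iff _ N).1 ((hmem _).1 hN)
      rw [hbot, sup_bot_eq] at h1
      have h2 : Ring.jacobson R • (⊤ : Submodule R S) ≤ ⊥ := Submodule.smul_le.2 fun r hr s _ =>
        Module.mem_annihilator.1 (IsSemisimpleModule.jacobson_le_annihilator R S hr) s
      exact bot_ne_top (le_bot_iff.1 (h1 ▸ h2)).symm
    have hSn : S ∉ perp (pretorsion τ) := fun hSn =>
      not_subsingleton S ((isPseudocompl_perp hQp).1.2 S ⟨hSp, hperp ▸ hSn⟩)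
    obtain ⟨N, hN⟩ := not_forall.1 hSn
    obtain ⟨hN, hNtop⟩ := Classical.not_imp.1 hN
    have h1 := (smul_top_quotient_eq_top_iff _ N).1 ((mem_pretorsion_iff hτ).1 hN)
    rwa [(eq_bot_or_eq_top N).resolve_right hNtop, sup_bot_eq] at h1
  have hMτ : ModuleCat.of R M ∈ perp (pretorsion τ) :=
    hperp ▸ subset_perp_perp hQ ((hmem (ModuleCat.of R M)).2 hM)
  -- Since τ(R) = R, every module is τ-pretorsion, so M lies both in 𝕋_τ and in its
  -- pseudocomplement.
  refine (isPseudocompl_perp (pretorsion_mem_quotClasses τ)).1.2 _ ⟨?_, hMτ⟩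
  rw [mem_pretorsion_iff hτ, hτtop, Submodule.top_smul]

end Main

end CoFirst

theorem mainTheorem5 (R : Type u) [Ring R] (hR : CoFirst.IsSemilocal R) :
    CoFirst.IsLeftPerfect R ↔ CoFirst.CN (CoFirst.tRad R) = CoFirst.conat R :=
  ⟨fun h => (CoFirst.CN_tRad_subset_conat R).antisymm
    (h.nakayamaProperty.conat_subset_CN_tRad hR),
    fun h => (CoFirst.nakayamaProperty_of_conat_subset h.ge).isLeftPerfect hR⟩
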